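/- Let $s\in(0,1)$ and let $f$ be the meromorphic function on $\mathbb{C}$ given by $$f(\beta)=\frac{\Gamma(\beta+1)\,\sin(\pi s)}{\Gamma(\beta-2s+1)\,\sin(\pi(\beta-2s))}\left(\frac{\sin(\pi(\beta-s))}{\sin(\pi s)}+\frac{\Gamma(2s-\beta)\,\Gamma(\beta+1)}{\Gamma(2s)}\right).$$ A zero of $f$ means a zero of this meromorphic function, i.e. a point at which its order is positive. Then the following hold. (i) If $s\le\frac12$, then there is $\alpha>0$ such that $f$ has no zeros in the strip $\{\beta\in\mathbb{C}: 0<\operatorname{Re}\beta<2s+\alpha\}$. Moreover, $f$ has at least one zero in the strip $\{\beta\in\mathbb{C}: 2s<\operatorname{Re}\beta<2s+\frac12\}$. (ii) If $s\ge\frac12$, then there is $\alpha>0$ such that $f$ has no zeros in the strip $\{\beta\in\mathbb{C}: 2s-1<\operatorname{Re}\beta<s+\frac12+\alpha\}$. Moreover, $f$ has at least one zero in the strip $\{\beta\in\mathbb{C}: s+\frac12<\operatorname{Re}\beta<s+1\}$. Here $\alpha$ may depend on $s$. -/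

import Mathlib

/-- The symbol `f` of the one-dimensional nonlocal Neumann problem of order `2s`, given by the
explicit Gamma/sine formula. As a meromorphic function on `ℂ` it is determined by this formula away
from the (discrete) set of points where a factor is singular; the values that Lean assigns at those
points play no role, since zeros are counted by `IsZeroOf`. -/
noncomputable def neumannSymbol (s : ℝ) (β : ℂ) : ℂ :=
  Complex.Gamma (β + 1) * Complex.sin (Real.pi * s) /
      (Complex.Gamma (β - 2 * s + 1) * Complex.sin (Real.pi * (β - 2 * s))) *
    (Complex.sin (Real.pi * (β - s)) / Complex.sin (Real.pi * s) +
      Complex.Gamma (2 * s - β) * Complex.Gamma (β + 1) / Complex.Gamma (2 * s))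

/-- `β` is a zero of the meromorphic function `g`: the order of `g` at `β` is positive. In
particular a pole is not a zero, and the value of `g` at the single point `β` is irrelevant. -/
def IsZeroOf (g : ℂ → ℂ) (β : ℂ) : Prop :=
  0 < meromorphicOrderAt g β

/-- The symbol is meromorphic on the whole complex plane. -/
theorem neumannSymbol_meromorphicAt (s : ℝ) (β : ℂ) : MeromorphicAt (neumannSymbol s) β := by
  have hG : ∀ {u : ℂ → ℂ}, AnalyticAt ℂ u β → MeromorphicAt (fun z => Complex.Gamma (u z)) β :=
    fun hu => (Meromorphic.Gamma _).comp_analyticAt hu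
  have h1 : MeromorphicAt (fun z : ℂ => Complex.Gamma (z + 1)) β := hG (by fun_prop)
  have h2 : MeromorphicAt (fun z : ℂ => Complex.Gamma (z - 2 * s + 1)) β := hG (by fun_prop)
  have h3 : MeromorphicAt (fun z : ℂ => Complex.Gamma (2 * s - z)) β := hG (by fun_prop)
  have h4 : ∀ c : ℂ, MeromorphicAt (fun z : ℂ => Complex.sin (Real.pi * (z - c))) β := fun c =>
    (Complex.analyticAt_sin.comp (f := fun z : ℂ => Real.pi * (z - c))
      (by fun_prop)).meromorphicAt
  have hc : ∀ c : ℂ, MeromorphicAt (fun _ : ℂ => c) β := fun c => MeromorphicAt.const c β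
  exact ((h1.mul (hc _)).div (h2.mul (h4 _))).mul
    (((h4 _).div (hc _)).add ((h3.mul h1).div (hc _)))

/-!
In the variable `z = β - s + 1 / 2` the zeros of the symbol are the solutions of `F z = 1`, where
`F z = Γ (2 s) cos (π z) / (sin (π s) Γ (s + 1 / 2 + z) Γ (s + 1 / 2 - z))` is entire and real on
the real axis.

Everything rests on the fact that `Γ u / Γ w` lies in the upper half-plane when `w` has positive
imaginary part, `0 ≤ Re w` and `u - w ∈ (0, 2]`. Multiplying `F z` by `Γ u / Γ w` with
`u = s + 1 / 2 + z` gives a positive multiple of `cos (π z)` for `w = s + 1 / 2 - conj z`, and, by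
the reflection formula, of `cos (π s) + cos (π (2 z - s))` for `w = z + 1 / 2 - s`.

The first choice shows that `F z = 1` has no solution off the real axis with
`0 < Re z ≤ min (s + 1 / 2) 1`; for real `z > |s - 1 / 2|` in this range `F z < 1` by log-convexity
of `Γ`. As the solutions in a bounded vertical strip form a compact set, the solution-free strip
extends slightly to the right.

For the second choice the product is real on the lines `Re z = (s + 1) / 2` and
`Re z = 1 + s / 2`, negative and positive respectively, so `F` is not real there off the real axis,
and its imaginary part changes sign in between; this gives a point where `F` takes a real value
`L ≥ 1`. If `F (1 + s / 2) < 1`, then `F` maps the boundary of a tall rectangle between the two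
lines off the segment `[1, L]`, so by the open mapping theorem it attains every value in that
segment, including `1`. Otherwise `F` attains `1` on the real axis.
-/

section

open Complex ComplexConjugate Filter Set Topology
open scoped Real

/-! ### Quotients of values of `Γ` along a horizontal line -/

/-- For `0 < Im w`, the closed convex cone spanned by `1` and `w`, encoded by its two bounding
half-planes. It confines the quotients `Γ (w + c) / Γ w` with `0 ≤ c ≤ 1`, which join the two
edges. -/
def sectorCone (w : ℂ) : Set ℂ := {q | 0 ≤ q.im ∧ q.im * w.re ≤ q.re * w.im}

theorem isClosed_sectorCone (w : ℂ) : IsClosed (sectorCone w) :=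
  (isClosed_le continuous_const continuous_im).inter
    (isClosed_le (continuous_im.mul continuous_const) (continuous_re.mul continuous_const))

theorem ofReal_mul_mem_sectorCone {w q : ℂ} {t : ℝ} (ht : 0 ≤ t) (hq : q ∈ sectorCone w) :
    t * q ∈ sectorCone w := by
  refine ⟨?_, ?_⟩
  · rw [im_ofReal_mul]
    exact mul_nonneg ht hq.1
  · rw [im_ofReal_mul, re_ofReal_mul, mul_assoc, mul_assoc]
    exact mul_le_mul_of_nonneg_left hq.2 ht

theorem add_ofReal_ne_zero {w : ℂ} (hw : w.im ≠ 0) (c : ℝ) : w + c ≠ 0 := fun h =>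
  hw (by simpa using congrArg im h)

theorem im_div_add_mul {w : ℂ} (hw : w.im ≠ 0) (c : ℝ) (q : ℂ) :
    (w / (w + c) * q).im = (((1 - c) * normSq w + c * normSq (w + 1)) * q.im +
      c * (q.re * w.im - q.im * (w.re + 1))) / normSq (w + c) := by
  have hN : normSq (w + c) ≠ 0 := (normSq_pos.2 (add_ofReal_ne_zero hw c)).ne'
  rw [eq_div_iff hN]
  simp only [mul_im, div_re, div_im, add_re, add_im, ofReal_re, ofReal_im]
  field_simp
  simp only [normSq_apply, add_re, add_im, one_re, one_im]
  ring

theorem div_add_mul_mem_sectorCone {w q : ℂ} {c : ℝ} (hw : 0 < w.im) (hc0 : 0 ≤ c) (hc1 : c ≤ 1)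
    (hq : q ∈ sectorCone (w + 1)) : w / (w + c) * q ∈ sectorCone w := by
  obtain ⟨him, hslope⟩ := hq
  simp only [add_re, one_re, add_im, one_im, add_zero] at hslope
  have : 0 ≤ 1 - c := sub_nonneg.2 hc1
  have := sub_nonneg.2 hslope
  have hN : 0 < normSq (w + c) := normSq_pos.2 (add_ofReal_ne_zero hw.ne' c)
  have hre : (w / (w + c) * q).re * w.im - (w / (w + c) * q).im * w.re =
      normSq w * ((q.re * w.im - q.im * (w.re + 1)) + (1 - c) * q.im) / normSq (w + c) := by
    rw [eq_div_iff hN.ne']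
    simp only [mul_re, mul_im, div_re, div_im, add_re, add_im, ofReal_re, ofReal_im]
    field_simp
    simp only [normSq_apply]
    ring
  have hw2 := normSq_nonneg w
  have hw3 := normSq_nonneg (w + 1)
  refine ⟨?_, sub_nonneg.1 ?_⟩
  · rw [im_div_add_mul hw.ne']
    positivity
  · rw [hre]
    positivity

theorem im_div_add_mul_pos {w q : ℂ} {c : ℝ} (hw : 0 < w.im) (hc0 : 0 < c) (hc1 : c ≤ 1)
    (hq : q ∈ sectorCone (w + 1)) (hq0 : q ≠ 0) : 0 < (w / (w + c) * q).im := by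
  obtain ⟨him, hslope⟩ := hq
  simp only [add_re, one_re, add_im, one_im, add_zero] at hslope
  have hc : 0 ≤ 1 - c := sub_nonneg.2 hc1
  have hN : 0 < normSq (w + c) := normSq_pos.2 (add_ofReal_ne_zero hw.ne' c)
  have hw1 : 0 < normSq (w + 1) :=
    normSq_pos.2 (by exact_mod_cast add_ofReal_ne_zero hw.ne' 1)
  have hw2 := normSq_nonneg w
  rw [im_div_add_mul hw.ne']
  refine div_pos ?_ hN
  rcases him.eq_or_lt with h | h
  · have hre : 0 < q.re := by
      rw [← h, zero_mul] at hslope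
      exact (nonneg_of_mul_nonneg_left hslope hw).lt_of_ne fun h' =>
        hq0 (Complex.ext h'.symm h.symm)
    rw [← h, mul_zero, zero_mul, zero_add, sub_zero]
    positivity
  · have := sub_nonneg.2 hslope
    positivity

theorem prod_add_div_add_mem_sectorCone {c : ℝ} (hc0 : 0 ≤ c) (hc1 : c ≤ 1) (n : ℕ) {w : ℂ}
    (hw : 0 < w.im) : ∏ j ∈ Finset.range n, ((w + j) / (w + c + j)) ∈ sectorCone w := by
  induction n generalizing w with
  | zero => simp [sectorCone, hw.le]
  | succ n ih =>
    have hshift : ∏ j ∈ Finset.range n, ((w + (j + 1 : ℕ)) / (w + c + (j + 1 : ℕ))) =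
        ∏ j ∈ Finset.range n, ((w + 1 + j) / (w + 1 + c + j)) :=
      Finset.prod_congr rfl fun j _ => by push_cast; congr 1 <;> ring
    rw [Finset.prod_range_succ', mul_comm, hshift]
    simpa only [Nat.cast_zero, add_zero] using
      div_add_mul_mem_sectorCone hw hc0 hc1 (ih (w := w + 1) (by simpa using hw))

theorem GammaSeq_add_div_GammaSeq {w : ℂ} (hw : w.im ≠ 0) (c : ℝ) {n : ℕ} (hn : n ≠ 0) :
    GammaSeq (w + c) n / GammaSeq w n =
      ((n : ℝ) ^ c : ℝ) * ∏ j ∈ Finset.range (n + 1), ((w + j) / (w + c + j)) := by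
  have hn0 : (n : ℂ) ≠ 0 := Nat.cast_ne_zero.2 hn
  have hfact : (n.factorial : ℂ) ≠ 0 := Nat.cast_ne_zero.2 n.factorial_ne_zero
  have hpow : (n : ℂ) ^ w ≠ 0 := by simp [cpow_eq_zero_iff, hn0]
  have hprod : ∀ b : ℝ, ∏ j ∈ Finset.range (n + 1), (w + b + j) ≠ 0 := fun b =>
    Finset.prod_ne_zero_iff.2 fun j _ => by
      simpa [add_assoc] using add_ofReal_ne_zero hw (b + j)
  have hprod0 := hprod 0
  have hprodc := hprod c
  simp only [ofReal_zero, add_zero] at hprod0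
  rw [GammaSeq, GammaSeq, Finset.prod_div_distrib, cpow_add _ _ hn0,
    ofReal_cpow (Nat.cast_nonneg n)]
  push_cast
  field_simp

theorem Gamma_ne_zero_of_im_ne_zero {w : ℂ} (hw : w.im ≠ 0) : Gamma w ≠ 0 :=
  Gamma_ne_zero fun m h => hw (by simp [h])

theorem Gamma_add_div_Gamma_mem_sectorCone {c : ℝ} (hc0 : 0 ≤ c) (hc1 : c ≤ 1) {w : ℂ}
    (hw : 0 < w.im) : Gamma (w + c) / Gamma w ∈ sectorCone w := by
  refine (isClosed_sectorCone w).mem_of_tendsto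
    ((GammaSeq_tendsto_Gamma (w + c)).div (GammaSeq_tendsto_Gamma w)
      (Gamma_ne_zero_of_im_ne_zero hw.ne')) ?_
  filter_upwards [eventually_ne_atTop 0] with n hn
  rw [Pi.div_apply, GammaSeq_add_div_GammaSeq hw.ne' c hn]
  exact ofReal_mul_mem_sectorCone (by positivity) (prod_add_div_add_mem_sectorCone hc0 hc1 _ hw)

theorem im_Gamma_add_div_Gamma_pos {c : ℝ} (hc0 : 0 < c) (hc1 : c ≤ 1) {w : ℂ} (hw : 0 < w.im) :
    0 < (Gamma (w + c) / Gamma w).im := by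
  have hw1 : 0 < (w + 1).im := by simpa using hw
  have hG : Gamma (w + 1) ≠ 0 := Gamma_ne_zero_of_im_ne_zero hw1.ne'
  have hGc : Gamma (w + 1 + c) ≠ 0 := Gamma_ne_zero_of_im_ne_zero (by simpa using hw.ne')
  have hw0 : w ≠ 0 := fun h => by simp [h] at hw
  have hwc : w + c ≠ 0 := add_ofReal_ne_zero hw.ne' c
  have hshift : Gamma (w + c) / Gamma w =
      w / (w + c) * (Gamma (w + 1 + c) / Gamma (w + 1)) := by
    rw [add_right_comm, Gamma_add_one _ hwc, Gamma_add_one _ hw0]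
    field_simp
  rw [hshift]
  exact im_div_add_mul_pos hw hc0 hc1 (Gamma_add_div_Gamma_mem_sectorCone hc0.le hc1 hw1)
    (div_ne_zero hGc hG)

theorem im_Gamma_div_Gamma_pos {u w : ℂ} (him : u.im = w.im) (hw : 0 < w.im) (hre : 0 ≤ w.re)
    (hlt : w.re < u.re) (hle : u.re ≤ w.re + 2) : 0 < (Gamma u / Gamma w).im := by
  obtain ⟨c, rfl⟩ : ∃ c : ℝ, u = w + c :=
    ⟨u.re - w.re, Complex.ext (by simp) (by simp [him])⟩
  simp only [add_re, ofReal_re, lt_add_iff_pos_right, add_le_add_iff_left] at hlt hle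
  rcases le_or_gt c 1 with hc | hc
  · exact im_Gamma_add_div_Gamma_pos hlt hc hw
  set q := Gamma (w + (c - 1 : ℝ)) / Gamma w with hq
  have hq_im : 0 < q.im := im_Gamma_add_div_Gamma_pos (by linarith) (by linarith) hw
  have hq_re : 0 ≤ q.re := by
    have hslope :=
      (Gamma_add_div_Gamma_mem_sectorCone (c := c - 1) (by linarith) (by linarith) hw).2
    exact nonneg_of_mul_nonneg_left ((mul_nonneg hq_im.le hre).trans hslope) hw
  have hshift : Gamma (w + c) / Gamma w = (w + (c - 1 : ℝ)) * q := by
    rw [hq, ← mul_div_assoc, ← Gamma_add_one _ (add_ofReal_ne_zero hw.ne' _)]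
    push_cast
    congr 2
    ring
  rw [hshift, mul_im]
  simp only [add_re, add_im, ofReal_re, ofReal_im, add_zero]
  have : 0 < w.re + (c - 1) := by linarith
  positivity

/-! ### Bounds for `Γ` and the cosine -/

theorem norm_Gamma_le_Gamma_re {w : ℂ} (hw : 0 < w.re) : ‖Gamma w‖ ≤ Real.Gamma w.re := by
  rw [Gamma_eq_integral hw, Real.Gamma_eq_integral hw, GammaIntegral]
  refine (MeasureTheory.norm_integral_le_integral_norm _).trans_eq
    (MeasureTheory.setIntegral_congr_fun measurableSet_Ioi fun x (hx : 0 < x) => ?_)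
  simp [norm_cpow_eq_rpow_re_of_pos hx, Complex.norm_exp]

theorem norm_Gamma_le_norm_Gamma_add_natCast {u : ℂ} (hu : 1 ≤ |u.im|) (n : ℕ) :
    ‖Gamma u‖ ≤ ‖Gamma (u + n)‖ := by
  induction n with
  | zero => simp
  | succ n ih =>
    have hnorm : 1 ≤ ‖u + n‖ := by simpa using hu.trans (by simpa using abs_im_le_norm (u + n))
    rw [Nat.cast_succ, ← add_assoc, Gamma_add_one _ (norm_pos_iff.1 (one_pos.trans_le hnorm)),
      norm_mul]
    exact ih.trans (le_mul_of_one_le_left (norm_nonneg _) hnorm)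

theorem exists_norm_Gamma_le_of_one_le_abs_im (a b : ℝ) :
    ∃ M : ℝ, 0 < M ∧ ∀ u : ℂ, u.re ∈ Icc a b → 1 ≤ |u.im| → ‖Gamma u‖ ≤ M := by
  obtain ⟨n, hn⟩ := exists_nat_gt (-a)
  have hcont : ContinuousOn Real.Gamma (Icc (a + n) (b + n)) := fun x hx =>
    (Real.differentiableOn_Gamma_Ioi x
      (by simp only [mem_Ioi]; linarith [hx.1])).continuousWithinAt.mono
      fun y hy => by simp only [mem_Ioi]; linarith [hy.1]
  obtain ⟨M, hM⟩ := isCompact_Icc.bddAbove_image hcont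
  refine ⟨max M 1, by positivity, fun u hu him => ?_⟩
  calc ‖Gamma u‖ ≤ ‖Gamma (u + n)‖ := norm_Gamma_le_norm_Gamma_add_natCast him n
    _ ≤ Real.Gamma (u + n).re := norm_Gamma_le_Gamma_re (by simp; linarith [hu.1])
    _ ≤ M := hM ⟨u.re + n, ⟨by linarith [hu.1], by linarith [hu.2]⟩, by simp⟩
    _ ≤ max M 1 := le_max_left _ _

theorem add_le_add_of_convexOn {S : Set ℝ} {f : ℝ → ℝ} (hf : ConvexOn ℝ S f) {p q u v : ℝ}
    (hp : p ∈ S) (hq : q ∈ S) (hpu : p ≤ u) (huq : u ≤ q) (hsum : p + q = u + v) :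
    f u + f v ≤ f p + f q := by
  obtain ⟨a, b, ha, hb, hab, hu⟩ := (segment_eq_Icc (hpu.trans huq)).symm ▸ mem_Icc.2 ⟨hpu, huq⟩
  have hv : b * p + a * q = v := by
    simp only [smul_eq_mul] at hu
    linear_combination (p + q) * hab + hsum - hu
  have hfu := hf.2 hp hq ha hb hab
  have hfv := hf.2 hp hq hb ha (add_comm b a ▸ hab)
  rw [hu] at hfu
  simp only [smul_eq_mul] at hfu hfv
  rw [hv] at hfv
  linear_combination hfu + hfv + (f p + f q) * hab

theorem Gamma_mul_Gamma_le_of_add_eq {p q u v : ℝ} (hp : 0 < p) (hpu : p ≤ u) (huq : u ≤ q)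
    (hsum : p + q = u + v) :
    Real.Gamma u * Real.Gamma v ≤ Real.Gamma p * Real.Gamma q := by
  have hu : 0 < u := hp.trans_le hpu
  have hq : 0 < q := hu.trans_le huq
  have hv : 0 < v := by linarith
  have hlog := add_le_add_of_convexOn Real.convexOn_log_Gamma hp hq hpu huq hsum
  have hΓ := fun {t : ℝ} (ht : 0 < t) => Real.Gamma_pos_of_pos ht
  rwa [← Real.log_le_log_iff (mul_pos (hΓ hu) (hΓ hv)) (mul_pos (hΓ hp) (hΓ hq)),
    Real.log_mul (hΓ hu).ne' (hΓ hv).ne', Real.log_mul (hΓ hp).ne' (hΓ hq).ne']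

theorem re_cos (z : ℂ) : (cos z).re = Real.cos z.re * Real.cosh z.im := by
  rw [cos_eq, ← ofReal_cos, ← ofReal_cosh, ← ofReal_sin, ← ofReal_sinh]
  simp only [sub_re, mul_re, mul_im, ofReal_re, ofReal_im, I_re, I_im]
  ring

theorem im_cos (z : ℂ) : (cos z).im = -(Real.sin z.re * Real.sinh z.im) := by
  rw [cos_eq, ← ofReal_cos, ← ofReal_cosh, ← ofReal_sin, ← ofReal_sinh]
  simp only [sub_im, mul_re, mul_im, ofReal_re, ofReal_im, I_re, I_im]
  ring

theorem abs_im_le_norm_cos (z : ℂ) : |z.im| ≤ ‖cos z‖ := by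
  have hsinh : |Real.sinh z.im| ≤ ‖cos z‖ := by
    have h := abs_norm_sub_norm_le (exp (z * I)) (-exp (-z * I))
    rw [norm_neg, Complex.norm_exp, Complex.norm_exp, sub_neg_eq_add, ← two_cos] at h
    simp only [mul_re, neg_re, neg_im, I_re, I_im, mul_zero, mul_one, zero_sub, neg_neg,
      norm_mul, Complex.norm_ofNat] at h
    rw [Real.sinh_eq, abs_div, abs_sub_comm, abs_two]
    linarith
  calc |z.im| ≤ Real.sinh |z.im| := Real.self_le_sinh_iff.2 (abs_nonneg _)
    _ = |Real.sinh z.im| := (Real.abs_sinh _).symm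
    _ ≤ ‖cos z‖ := hsinh

/-! ### Boundary values of open maps and zeros of quotients -/

theorem subset_image_of_disjoint_image_frontier {X Y : Type*} [TopologicalSpace X]
    [TopologicalSpace Y] [T2Space Y] {f : X → Y} (hf : Continuous f) (hopen : IsOpenMap f)
    {K : Set X} (hK : IsCompact K) {C : Set Y} (hC : IsPreconnected C)
    (hfr : Disjoint C (f '' frontier K)) (hne : (C ∩ f '' K).Nonempty) : C ⊆ f '' K := by
  have hint : C ∩ f '' K ⊆ f '' interior K := by
    rintro _ ⟨hy, x, hx, rfl⟩
    refine ⟨x, by_contra fun hxi => ?_, rfl⟩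
    exact hfr.notMem_of_mem_left hy ⟨x, ⟨subset_closure hx, hxi⟩, rfl⟩
  have hcover : C ⊆ f '' interior K ∪ (f '' K)ᶜ := fun y hy =>
    (em (y ∈ f '' K)).imp (fun h => hint ⟨hy, h⟩) id
  refine (hC.subset_left_of_subset_union (hopen _ isOpen_interior)
    (hK.image hf).isClosed.isOpen_compl ?_ hcover ?_).trans (image_mono interior_subset)
  · exact disjoint_compl_right_iff_subset.2 (image_mono interior_subset)
  · exact hne.mono fun y hy => ⟨hy.1, hint hy⟩

theorem eventually_ne_zero_of_differentiable {f : ℂ → ℂ} (hf : Differentiable ℂ f) {x : ℂ}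
    (hx : f x ≠ 0) (z : ℂ) : ∀ᶠ w in 𝓝[≠] z, f w ≠ 0 := by
  have h := mem_codiscreteWithin_iff_forall_mem_nhdsNE.1
    ((analyticOnNhd_univ_iff_differentiable.2 hf).preimage_zero_mem_codiscrete hx) z trivial
  rwa [compl_univ, union_empty] at h

theorem meromorphicOrderAt_div_pos_iff {f g : ℂ → ℂ} {z : ℂ} (hf : AnalyticAt ℂ f z)
    (hg : AnalyticAt ℂ g z) (hg0 : ∀ᶠ w in 𝓝[≠] z, g w ≠ 0) (hfg : f z = 0 → g z ≠ 0) :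
    0 < meromorphicOrderAt (f / g) z ↔ f z = 0 := by
  rw [← tendsto_zero_iff_meromorphicOrderAt_pos (hf.meromorphicAt.div hg.meromorphicAt)]
  have hf_lim : Tendsto f (𝓝[≠] z) (𝓝 (f z)) := hf.continuousAt.mono_left nhdsWithin_le_nhds
  have hg_lim : Tendsto g (𝓝[≠] z) (𝓝 (g z)) := hg.continuousAt.mono_left nhdsWithin_le_nhds
  refine ⟨fun h => ?_, fun h => by simpa [h] using hf_lim.div hg_lim (hfg h)⟩
  have hf_lim' : Tendsto f (𝓝[≠] z) (𝓝 (0 * g z)) :=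
    (h.mul hg_lim).congr' (hg0.mono fun w hw => div_mul_cancel₀ (f w) hw)
  exact (tendsto_nhds_unique hf_lim hf_lim').trans (zero_mul _)

/-! ### The symbol in the centred variable -/

/-- The positive constant `Γ (2 s) / sin (π s)` in `reducedSymbol`. -/
noncomputable def symbolConst (s : ℝ) : ℝ := Real.Gamma (2 * s) / Real.sin (π * s)

/-- The entire function `1 / (Γ (s + 1 / 2 + z) Γ (s + 1 / 2 - z))`, which vanishes at the poles of
the two Gamma factors because Mathlib sets `Γ` to `0` there. -/
noncomputable def recipGammaProd (s : ℝ) (z : ℂ) : ℂ :=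
  (Gamma (s + 1 / 2 + z))⁻¹ * (Gamma (s + 1 / 2 - z))⁻¹

/-- In the centred variable `z = β - s + 1 / 2`, the entire function that takes the value `1`
exactly at the zeros of the symbol. -/
noncomputable def reducedSymbol (s : ℝ) (z : ℂ) : ℂ :=
  symbolConst s * cos (π * z) * recipGammaProd s z

variable {s : ℝ} {z : ℂ}

theorem sin_pi_mul_pos (hs0 : 0 < s) (hs1 : s < 1) : 0 < Real.sin (π * s) :=
  Real.sin_pos_of_pos_of_lt_pi (by positivity) (mul_lt_of_lt_one_right Real.pi_pos hs1)

theorem symbolConst_pos (hs0 : 0 < s) (hs1 : s < 1) : 0 < symbolConst s :=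
  div_pos (Real.Gamma_pos_of_pos (by positivity)) (sin_pi_mul_pos hs0 hs1)

theorem differentiable_recipGammaProd (s : ℝ) : Differentiable ℂ (recipGammaProd s) :=
  (differentiable_one_div_Gamma.comp (differentiable_id.const_add _)).mul
    (differentiable_one_div_Gamma.comp (differentiable_id.const_sub _))

theorem differentiable_reducedSymbol (s : ℝ) : Differentiable ℂ (reducedSymbol s) :=
  Differentiable.mul (by fun_prop) (differentiable_recipGammaProd s)

theorem reducedSymbol_conj (s : ℝ) (z : ℂ) :
    reducedSymbol s (conj z) = conj (reducedSymbol s z) := by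
  simp only [reducedSymbol, recipGammaProd, map_mul, map_inv₀, ← Gamma_conj, ← cos_conj, map_add,
    map_sub, map_div₀, conj_ofReal, map_one, map_ofNat]

theorem reducedSymbol_ofReal (s x : ℝ) : reducedSymbol s x =
    ((symbolConst s * Real.cos (π * x) *
      ((Real.Gamma (s + 1 / 2 + x))⁻¹ * (Real.Gamma (s + 1 / 2 - x))⁻¹) : ℝ) : ℂ) := by
  simp only [reducedSymbol, recipGammaProd, ofReal_mul, ofReal_inv, ← Gamma_ofReal, ofReal_cos,
    ofReal_add, ofReal_sub, ofReal_div, ofReal_one, ofReal_ofNat]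

theorem Gamma_two_mul_ne_zero (hs0 : 0 < s) : Gamma (2 * s) ≠ 0 :=
  Gamma_ne_zero_of_re_pos (by simpa using hs0)

theorem Gamma_add_one_mul_sin_pi_mul {w : ℂ} (hw : sin (π * w) ≠ 0) :
    Gamma (w + 1) * sin (π * w) = -π / Gamma (-w) := by
  have hw0 : Gamma (-w) ≠ 0 := Gamma_ne_zero fun m hm => hw <| by
    rw [neg_inj.1 hm, mul_comm, sin_nat_mul_pi]
  have hrefl := Gamma_mul_Gamma_one_sub (-w)
  rw [mul_neg, sin_neg, sub_neg_eq_add, add_comm 1 w, eq_div_iff (neg_ne_zero.2 hw)] at hrefl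
  rw [eq_div_iff hw0]
  linear_combination -hrefl

theorem neumannSymbol_eq_div (hs0 : 0 < s) (hs1 : s < 1) {β : ℂ}
    (h : sin (π * (β - 2 * s)) ≠ 0) :
    neumannSymbol s β = (reducedSymbol s (β - s + 1 / 2) - 1) /
      (π * symbolConst s * recipGammaProd s (β - s + 1 / 2) ^ 2) := by
  have hS : sin (π * s) ≠ 0 := by exact_mod_cast (sin_pi_mul_pos hs0 hs1).ne'
  have hG := Gamma_two_mul_ne_zero hs0
  have hA : Gamma (2 * s - β) ≠ 0 := Gamma_ne_zero fun m hm => h <| by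
    rw [← neg_sub, hm, neg_neg, mul_comm, sin_nat_mul_pi]
  have hden : Gamma (β - 2 * s + 1) * sin (π * (β - 2 * s)) = -π / Gamma (2 * s - β) := by
    simpa only [neg_sub] using Gamma_add_one_mul_sin_pi_mul h
  have hcos : cos (π * (β - s + 1 / 2)) = -sin (π * (β - s)) := by
    rw [← cos_add_pi_div_two]
    ring_nf
  have hK : (symbolConst s : ℂ) = Gamma (2 * s) / sin (π * s) := by
    rw [symbolConst, ofReal_div, ← Gamma_ofReal]
    push_cast
    rfl
  rw [neumannSymbol, hden, reducedSymbol, recipGammaProd, hcos, hK,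
    show (s : ℂ) + 1 / 2 + (β - s + 1 / 2) = β + 1 by ring,
    show (s : ℂ) + 1 / 2 - (β - s + 1 / 2) = 2 * s - β by ring]
  rcases eq_or_ne (Gamma (β + 1)) 0 with hB | hB
  · simp [hB]
  · generalize Gamma (β + 1) = B at *
    generalize Gamma (2 * s - β) = A at *
    generalize Gamma (2 * s : ℂ) = G at *
    field_simp
    ring

theorem isZeroOf_neumannSymbol_iff (hs0 : 0 < s) (hs1 : s < 1) (β : ℂ) :
    IsZeroOf (neumannSymbol s) β ↔ reducedSymbol s (β - s + 1 / 2) = 1 := by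
  have hc : (π * symbolConst s : ℂ) ≠ 0 := by
    exact_mod_cast mul_ne_zero Real.pi_ne_zero (symbolConst_pos hs0 hs1).ne'
  have hr : Differentiable ℂ fun w : ℂ => recipGammaProd s (w - s + 1 / 2) :=
    (differentiable_recipGammaProd s).comp (by fun_prop)
  have hF : Differentiable ℂ fun w : ℂ => reducedSymbol s (w - s + 1 / 2) - 1 :=
    ((differentiable_reducedSymbol s).comp (by fun_prop)).sub_const 1
  have hg : Differentiable ℂ fun w : ℂ =>
      π * symbolConst s * recipGammaProd s (w - s + 1 / 2) ^ 2 := by fun_prop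
  have hsin : ∀ᶠ w in 𝓝[≠] β, sin (π * (w - 2 * s)) ≠ 0 :=
    eventually_ne_zero_of_differentiable (x := 2 * s + 1 / 2) (by fun_prop)
      (by simp [← div_eq_mul_inv]) β
  have hr0 : recipGammaProd s (0 - s + 1 / 2) ≠ 0 := by
    rw [recipGammaProd, show (s : ℂ) + 1 / 2 + (0 - s + 1 / 2) = 1 by ring,
      show (s : ℂ) + 1 / 2 - (0 - s + 1 / 2) = 2 * s by ring, Gamma_one]
    simpa using Gamma_two_mul_ne_zero hs0
  have heq : neumannSymbol s =ᶠ[𝓝[≠] β] (fun w => reducedSymbol s (w - s + 1 / 2) - 1) /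
      fun w => π * symbolConst s * recipGammaProd s (w - s + 1 / 2) ^ 2 :=
    hsin.mono fun w hw => neumannSymbol_eq_div hs0 hs1 hw
  rw [IsZeroOf, meromorphicOrderAt_congr heq, meromorphicOrderAt_div_pos_iff (hF.analyticAt β)
    (hg.analyticAt β), sub_eq_zero]
  · filter_upwards [eventually_ne_zero_of_differentiable hr hr0 β] with w hw
    exact mul_ne_zero hc (pow_ne_zero 2 hw)
  · intro h
    refine mul_ne_zero hc (pow_ne_zero 2 fun h0 => ?_)
    simp only [reducedSymbol, h0, mul_zero, zero_sub, neg_eq_zero, one_ne_zero] at h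

theorem reducedSymbol_mul_Gamma_div_Gamma_sub_conj (s : ℝ) (hz : z.im ≠ 0) :
    reducedSymbol s z * (Gamma (s + 1 / 2 + z) / Gamma (s + 1 / 2 - conj z)) =
      (symbolConst s / normSq (Gamma (s + 1 / 2 - conj z)) : ℝ) * cos (π * z) := by
  have hu : Gamma (s + 1 / 2 + z) ≠ 0 := Gamma_ne_zero_of_im_ne_zero (by simpa using hz)
  have hconj : Gamma (s + 1 / 2 - z) = conj (Gamma (s + 1 / 2 - conj z)) := by
    rw [← Gamma_conj, map_sub, map_add, map_div₀, conj_conj, conj_ofReal, map_one, map_ofNat]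
  rw [reducedSymbol, recipGammaProd, hconj, ofReal_div, ← mul_conj]
  generalize Gamma (s + 1 / 2 + z) = U at *
  generalize Gamma (s + 1 / 2 - conj z) = W
  field_simp

theorem reducedSymbol_mul_Gamma_div_Gamma_sub (s : ℝ) (hz : z.im ≠ 0) :
    reducedSymbol s z * (Gamma (s + 1 / 2 + z) / Gamma (z + 1 / 2 - s)) =
      (symbolConst s / (2 * π) : ℝ) * (cos (π * s) + cos (π * (2 * z - s))) := by
  have hu : Gamma (s + 1 / 2 + z) ≠ 0 := Gamma_ne_zero_of_im_ne_zero (by simpa using hz)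
  have hw : Gamma (z + 1 / 2 - s) ≠ 0 := Gamma_ne_zero_of_im_ne_zero (by simpa using hz)
  have hπ : (π : ℂ) ≠ 0 := ofReal_ne_zero.2 Real.pi_ne_zero
  have hrefl : Gamma (z + 1 / 2 - s) * Gamma (s + 1 / 2 - z) = π / cos (π * (z - s)) := by
    rw [← sin_add_pi_div_two, show (π : ℂ) * (z - s) + π / 2 = π * (z + 1 / 2 - s) by ring,
      ← Gamma_mul_Gamma_one_sub]
    ring_nf
  have hinv : (Gamma (s + 1 / 2 - z))⁻¹ = Gamma (z + 1 / 2 - s) * cos (π * (z - s)) / π := by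
    rw [eq_div_of_mul_eq hw (mul_comm _ _ |>.trans hrefl), inv_div, div_div_eq_mul_div]
  have hcos : cos (π * s) + cos (π * (2 * z - s)) = 2 * cos (π * z) * cos (π * (z - s)) := by
    rw [cos_add_cos, ← cos_neg ((π * s - π * (2 * z - s)) / 2)]
    ring_nf
  rw [reducedSymbol, recipGammaProd, hinv, hcos]
  generalize Gamma (s + 1 / 2 + z) = U at *
  generalize Gamma (z + 1 / 2 - s) = W at *
  push_cast
  field_simp

/-! ### A region where the reduced symbol omits the value `1` -/

theorem im_cos_pi_mul_nonpos (hz0 : 0 ≤ z.re) (hz1 : z.re ≤ 1) (him : 0 ≤ z.im) :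
    (cos (π * z)).im ≤ 0 := by
  rw [im_cos, re_ofReal_mul, im_ofReal_mul, neg_nonpos]
  refine mul_nonneg (Real.sin_nonneg_of_nonneg_of_le_pi (by positivity) ?_)
    (Real.sinh_nonneg_iff.2 (by positivity))
  exact mul_le_of_le_one_right Real.pi_pos.le hz1

theorem reducedSymbol_ne_one_of_im_pos (hK : 0 ≤ symbolConst s) (hz0 : 0 < z.re)
    (hzs : z.re ≤ s + 1 / 2) (hz1 : z.re ≤ 1) (him : 0 < z.im) : reducedSymbol s z ≠ 1 := by
  intro h
  have hR : 0 < (Gamma (s + 1 / 2 + z) / Gamma (s + 1 / 2 - conj z)).im := by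
    apply im_Gamma_div_Gamma_pos <;> simp <;> linarith
  have hid := reducedSymbol_mul_Gamma_div_Gamma_sub_conj s him.ne'
  rw [h, one_mul] at hid
  rw [hid, im_ofReal_mul] at hR
  exact hR.not_ge (mul_nonpos_of_nonneg_of_nonpos (div_nonneg hK (normSq_nonneg _))
    (im_cos_pi_mul_nonpos hz0.le hz1 him.le))

theorem cos_pi_mul_lt_sin_pi_mul {x : ℝ} (h0 : |s - 1 / 2| < x) (hx1 : x ≤ 1) :
    Real.cos (π * x) < Real.sin (π * s) := by
  rw [← Real.cos_pi_div_two_sub, ← Real.cos_abs (_ - _)]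
  refine Real.cos_lt_cos_of_nonneg_of_le_pi (abs_nonneg _)
    (mul_le_of_le_one_right Real.pi_pos.le hx1) ?_
  rw [show π / 2 - π * s = π * -(s - 1 / 2) by ring, abs_mul, abs_neg, abs_of_pos Real.pi_pos]
  exact mul_lt_mul_of_pos_left h0 Real.pi_pos

theorem re_reducedSymbol_ofReal_lt_one (hs0 : 0 < s) (hs1 : s < 1) {x : ℝ}
    (h0 : |s - 1 / 2| < x) (hxs : x ≤ s + 1 / 2) (hx1 : x ≤ 1) : (reducedSymbol s x).re < 1 := by
  rw [reducedSymbol_ofReal, ofReal_re]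
  rcases hxs.eq_or_lt with rfl | hxs
  · simp [Real.Gamma_zero]
  obtain ⟨ha, hb⟩ := abs_lt.1 h0
  have hS := sin_pi_mul_pos hs0 hs1
  have hG : 0 < Real.Gamma (2 * s) := Real.Gamma_pos_of_pos (by positivity)
  have : 0 < Real.Gamma (s + 1 / 2 - x) := Real.Gamma_pos_of_pos (by linarith)
  have hq : 0 < Real.Gamma (s + 1 / 2 + x) := Real.Gamma_pos_of_pos (by linarith)
  have hle : Real.Gamma (2 * s) ≤ Real.Gamma (s + 1 / 2 - x) * Real.Gamma (s + 1 / 2 + x) := by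
    simpa only [Real.Gamma_one, mul_one] using
      Gamma_mul_Gamma_le_of_add_eq (p := s + 1 / 2 - x) (q := s + 1 / 2 + x) (u := 2 * s) (v := 1)
        (by linarith) (by linarith) (by linarith) (by ring)
  calc symbolConst s * Real.cos (π * x) *
        ((Real.Gamma (s + 1 / 2 + x))⁻¹ * (Real.Gamma (s + 1 / 2 - x))⁻¹)
      = Real.cos (π * x) * Real.Gamma (2 * s) / (Real.sin (π * s) *
          (Real.Gamma (s + 1 / 2 - x) * Real.Gamma (s + 1 / 2 + x))) := by
        rw [symbolConst]
        field_simp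
    _ < 1 := by
        rw [div_lt_one (by positivity)]
        exact (mul_lt_mul_of_pos_right (cos_pi_mul_lt_sin_pi_mul h0 hx1) hG).trans_le
          (mul_le_mul_of_nonneg_left hle hS.le)

theorem reducedSymbol_ne_one (hs0 : 0 < s) (hs1 : s < 1) (h0 : |s - 1 / 2| < z.re)
    (h1 : z.re ≤ min (s + 1 / 2) 1) : reducedSymbol s z ≠ 1 := by
  have hz0 : 0 < z.re := (abs_nonneg _).trans_lt h0
  obtain ⟨hzs, hz1⟩ := le_min_iff.1 h1
  have hK := (symbolConst_pos hs0 hs1).le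
  rcases lt_trichotomy z.im 0 with him | him | him
  · intro h
    refine reducedSymbol_ne_one_of_im_pos (z := conj z) hK ?_ ?_ ?_ ?_
      (by rw [reducedSymbol_conj, h, map_one]) <;>
      simpa only [conj_re, conj_im, neg_pos]
  · intro h
    have hlt := re_reducedSymbol_ofReal_lt_one hs0 hs1 h0 hzs hz1
    rw [show (z.re : ℂ) = z from Complex.ext rfl him.symm, h, one_re] at hlt
    exact hlt.false
  · exact reducedSymbol_ne_one_of_im_pos hK hz0 hzs hz1 him

theorem exists_lt_norm_reducedSymbol (hK : 0 < symbolConst s) (a b L : ℝ) :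
    ∃ Y : ℝ, 0 < Y ∧ ∀ z : ℂ, z.re ∈ Icc a b → Y ≤ |z.im| → L < ‖reducedSymbol s z‖ := by
  obtain ⟨M₁, hM₁, hΓ₁⟩ := exists_norm_Gamma_le_of_one_le_abs_im (s + 1 / 2 + a) (s + 1 / 2 + b)
  obtain ⟨M₂, hM₂, hΓ₂⟩ := exists_norm_Gamma_le_of_one_le_abs_im (s + 1 / 2 - b) (s + 1 / 2 - a)
  refine ⟨max 1 (L * (M₁ * M₂) / symbolConst s + 1), by positivity, fun z hz hY => ?_⟩
  obtain ⟨hY1, hYL⟩ := max_le_iff.1 hY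
  have hu := hΓ₁ (s + 1 / 2 + z) (by simpa using hz) (by simpa using hY1)
  have hv := hΓ₂ (s + 1 / 2 - z)
    (by constructor <;> simp <;> linarith [hz.1, hz.2]) (by simpa using hY1)
  have hu0 : Gamma (s + 1 / 2 + z) ≠ 0 :=
    Gamma_ne_zero_of_im_ne_zero (abs_pos.1 (by simpa using one_pos.trans_le hY1))
  have hv0 : Gamma (s + 1 / 2 - z) ≠ 0 :=
    Gamma_ne_zero_of_im_ne_zero (abs_pos.1 (by simpa using one_pos.trans_le hY1))
  have hcos : |z.im| ≤ ‖cos (π * z)‖ :=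
    calc |z.im| ≤ π * |z.im| :=
          le_mul_of_one_le_left (abs_nonneg _) (by linarith [Real.two_le_pi])
      _ = |(π * z).im| := by rw [im_ofReal_mul, abs_mul, abs_of_pos Real.pi_pos]
      _ ≤ ‖cos (π * z)‖ := abs_im_le_norm_cos _
  refine lt_of_mul_lt_mul_right ?_ (mul_pos hM₁ hM₂).le
  calc L * (M₁ * M₂) = symbolConst s * (L * (M₁ * M₂) / symbolConst s) := by field_simp
    _ < symbolConst s * ‖cos (π * z)‖ := mul_lt_mul_of_pos_left (by linarith) hK
    _ = ‖reducedSymbol s z‖ * (‖Gamma (s + 1 / 2 + z)‖ * ‖Gamma (s + 1 / 2 - z)‖) := by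
        rw [reducedSymbol, recipGammaProd, ← mul_inv, ← norm_mul, ← norm_mul,
          inv_mul_cancel_right₀ (mul_ne_zero hu0 hv0), norm_mul, norm_real,
          Real.norm_of_nonneg hK.le]
    _ ≤ ‖reducedSymbol s z‖ * (M₁ * M₂) := by gcongr

theorem isCompact_setOf_reducedSymbol_eq_one (hK : 0 < symbolConst s) (a b : ℝ) :
    IsCompact {z : ℂ | z.re ∈ Icc a b ∧ reducedSymbol s z = 1} := by
  obtain ⟨Y, -, hY⟩ := exists_lt_norm_reducedSymbol hK a b 1
  have hrect : IsCompact (Icc a b ×ℂ Icc (-Y) Y) := isCompact_Icc.reProdIm isCompact_Icc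
  refine hrect.of_isClosed_subset
    ((isClosed_Icc.preimage continuous_re).inter
      (isClosed_singleton.preimage (differentiable_reducedSymbol s).continuous)) ?_
  rintro z ⟨hre, hz⟩
  refine ⟨hre, abs_le.1 (le_of_not_gt fun h => ?_)⟩
  simpa [hz] using hY z hre h.le

theorem exists_pos_forall_reducedSymbol_ne_one (hs0 : 0 < s) (hs1 : s < 1) :
    ∃ α : ℝ, 0 < α ∧ ∀ z : ℂ, |s - 1 / 2| < z.re → z.re < min (s + 1 / 2) 1 + α →
      reducedSymbol s z ≠ 1 := by
  set m := min (s + 1 / 2) 1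
  have hm : |s - 1 / 2| < m := by
    rw [abs_lt, lt_min_iff, neg_lt, lt_min_iff]
    constructor <;> constructor <;> linarith
  have hclosed := ((isCompact_setOf_reducedSymbol_eq_one (symbolConst_pos hs0 hs1) m
    (m + 1)).image continuous_re).isClosed
  have hmem : m ∉ re '' {z : ℂ | z.re ∈ Icc m (m + 1) ∧ reducedSymbol s z = 1} := by
    rintro ⟨z, ⟨-, hz⟩, hzm⟩
    exact reducedSymbol_ne_one hs0 hs1 (hzm ▸ hm) hzm.le hz
  obtain ⟨ε, hε, hball⟩ := Metric.isOpen_iff.1 hclosed.isOpen_compl m hmem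
  refine ⟨min ε 1, by positivity, fun z h0 h1 hz => ?_⟩
  have hlt := lt_min_iff.1 (sub_lt_iff_lt_add'.2 h1)
  rcases le_or_gt z.re m with hzm | hzm
  · exact reducedSymbol_ne_one hs0 hs1 h0 hzm hz
  · refine hball ?_ ⟨z, ⟨⟨hzm.le, by linarith⟩, hz⟩, rfl⟩
    rw [Metric.mem_ball, Real.dist_eq, abs_of_pos (sub_pos.2 hzm)]
    exact hlt.1

/-! ### A point where the reduced symbol equals `1` -/

theorem im_mul_normSq (a r : ℂ) : a.im * normSq r = (a * r).im * r.re - (a * r).re * r.im := by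
  simp only [normSq_apply, mul_re, mul_im]
  ring

theorem re_cos_pi_mul_add_cos_pi_mul (s : ℝ) (z : ℂ) : (cos (π * s) + cos (π * (2 * z - s))).re =
    Real.cos (π * s) + Real.cos (π * (2 * z.re - s)) * Real.cosh (π * (2 * z.im)) := by
  simp [re_cos]

theorem im_cos_pi_mul_add_cos_pi_mul (s : ℝ) (z : ℂ) : (cos (π * s) + cos (π * (2 * z - s))).im =
    -(Real.sin (π * (2 * z.re - s)) * Real.sinh (π * (2 * z.im))) := by
  simp [im_cos]

theorem im_Gamma_add_div_Gamma_sub_pos (hs0 : 0 < s) (hs1 : s < 1) (hre : s - 1 / 2 ≤ z.re)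
    (him : 0 < z.im) : 0 < (Gamma (s + 1 / 2 + z) / Gamma (z + 1 / 2 - s)).im := by
  apply im_Gamma_div_Gamma_pos <;> simp <;> linarith

theorem im_reducedSymbol_pos_of_re_eq (hs0 : 0 < s) (hs1 : s < 1) (hre : z.re = (s + 1) / 2)
    (him : 0 < z.im) : 0 < (reducedSymbol s z).im := by
  have hR := im_Gamma_add_div_Gamma_sub_pos hs0 hs1 (by linarith) him
  have hK := symbolConst_pos hs0 hs1
  have hid := reducedSymbol_mul_Gamma_div_Gamma_sub s him.ne'
  have hphase : π * (2 * z.re - s) = π := by rw [hre]; ring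
  have hcosh : 1 < Real.cosh (π * (2 * z.im)) := Real.one_lt_cosh.2 (by positivity)
  have hneg : Real.cos (π * s) - Real.cosh (π * (2 * z.im)) < 0 := by
    linarith [Real.cos_le_one (π * s), hcosh]
  refine pos_of_mul_pos_left ?_ (normSq_nonneg (Gamma (s + 1 / 2 + z) / Gamma (z + 1 / 2 - s)))
  rw [im_mul_normSq, hid, im_ofReal_mul, re_ofReal_mul, re_cos_pi_mul_add_cos_pi_mul,
    im_cos_pi_mul_add_cos_pi_mul, hphase, Real.sin_pi, Real.cos_pi, zero_mul, neg_zero, mul_zero,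
    zero_mul, zero_sub, neg_one_mul, ← sub_eq_add_neg, ← neg_mul]
  exact mul_pos (neg_pos.2 (mul_neg_of_pos_of_neg (by positivity) hneg)) hR

theorem im_reducedSymbol_neg_of_re_eq (hs0 : 0 < s) (hs1 : s < 1) (hre : z.re = 1 + s / 2)
    (him : 0 < z.im) : (reducedSymbol s z).im < 0 := by
  have hR := im_Gamma_add_div_Gamma_sub_pos hs0 hs1 (by linarith) him
  have hK := symbolConst_pos hs0 hs1
  have hid := reducedSymbol_mul_Gamma_div_Gamma_sub s him.ne'
  have hphase : π * (2 * z.re - s) = 2 * π := by rw [hre]; ring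
  have hcosh : 1 < Real.cosh (π * (2 * z.im)) := Real.one_lt_cosh.2 (by positivity)
  have hpos : 0 < Real.cos (π * s) + Real.cosh (π * (2 * z.im)) := by
    linarith [Real.neg_one_le_cos (π * s), hcosh]
  refine neg_of_mul_neg_left ?_ (normSq_nonneg (Gamma (s + 1 / 2 + z) / Gamma (z + 1 / 2 - s)))
  rw [im_mul_normSq, hid, im_ofReal_mul, re_ofReal_mul, re_cos_pi_mul_add_cos_pi_mul,
    im_cos_pi_mul_add_cos_pi_mul, hphase, Real.sin_two_pi, Real.cos_two_pi, zero_mul, neg_zero,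
    mul_zero, zero_mul, zero_sub, one_mul]
  exact neg_neg_of_pos (by positivity)

theorem im_reducedSymbol_ne_zero_of_re_eq (hs0 : 0 < s) (hs1 : s < 1)
    (hre : z.re = (s + 1) / 2 ∨ z.re = 1 + s / 2) (him : z.im ≠ 0) :
    (reducedSymbol s z).im ≠ 0 := by
  have hupper : ∀ {w : ℂ}, (w.re = (s + 1) / 2 ∨ w.re = 1 + s / 2) → 0 < w.im →
      (reducedSymbol s w).im ≠ 0 := fun hw him =>
    hw.elim (fun hw => (im_reducedSymbol_pos_of_re_eq hs0 hs1 hw him).ne')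
      fun hw => (im_reducedSymbol_neg_of_re_eq hs0 hs1 hw him).ne
  rcases him.lt_or_gt with him | him
  · have h := hupper (w := conj z) (by simpa using hre) (by simpa using him)
    rwa [reducedSymbol_conj, conj_im, neg_ne_zero] at h
  · exact hupper hre him

theorem re_reducedSymbol_nonneg_of_im_eq_zero (hs0 : 0 < s) (hs1 : s < 1) (h0 : (s + 1) / 2 ≤ z.re)
    (h1 : z.re ≤ 1 + s / 2) (him : 0 < z.im) (hreal : (reducedSymbol s z).im = 0) :
    0 ≤ (reducedSymbol s z).re := by
  have hR := im_Gamma_add_div_Gamma_sub_pos hs0 hs1 (by linarith) him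
  have hK := symbolConst_pos hs0 hs1
  have hid := congrArg im (reducedSymbol_mul_Gamma_div_Gamma_sub s him.ne')
  have hsin : Real.sin (π * (2 * z.re - s)) ≤ 0 := by
    rw [← neg_nonneg, ← Real.sin_sub_pi]
    apply Real.sin_nonneg_of_nonneg_of_le_pi <;> nlinarith [Real.pi_pos]
  have hsinh : 0 ≤ Real.sinh (π * (2 * z.im)) := Real.sinh_nonneg_iff.2 (by positivity)
  rw [mul_im, hreal, zero_mul, add_zero, im_ofReal_mul, im_cos_pi_mul_add_cos_pi_mul] at hid
  refine nonneg_of_mul_nonneg_left (hid ▸ mul_nonneg (by positivity) ?_) hR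
  exact neg_nonneg.2 (mul_nonpos_of_nonpos_of_nonneg hsin hsinh)

theorem exists_reducedSymbol_eq_ofReal (hs0 : 0 < s) (hs1 : s < 1) :
    ∃ (z : ℂ) (L : ℝ), z.re ∈ Icc ((s + 1) / 2) (1 + s / 2) ∧ 1 ≤ L ∧ reducedSymbol s z = L := by
  have hle : (s + 1) / 2 ≤ 1 + s / 2 := by linarith
  obtain ⟨Y, hY0, hY⟩ := exists_lt_norm_reducedSymbol (symbolConst_pos hs0 hs1) ((s + 1) / 2)
    (1 + s / 2) 1
  have hcont : Continuous fun t : ℝ => (reducedSymbol s (t + Y * I)).im :=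
    continuous_im.comp ((differentiable_reducedSymbol s).continuous.comp (by fun_prop))
  obtain ⟨t, ht, him⟩ := intermediate_value_Icc' hle hcont.continuousOn
    ⟨(im_reducedSymbol_neg_of_re_eq hs0 hs1 (by simp) (by simpa)).le,
      (im_reducedSymbol_pos_of_re_eq hs0 hs1 (by simp) (by simpa)).le⟩
  set z : ℂ := t + Y * I
  have hzre : z.re = t := by simp [z]
  have hzim : z.im = Y := by simp [z]
  have hreal : reducedSymbol s z = (reducedSymbol s z).re := Complex.ext rfl him
  have hnonneg : 0 ≤ (reducedSymbol s z).re :=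
    re_reducedSymbol_nonneg_of_im_eq_zero hs0 hs1 (hzre ▸ ht.1) (hzre ▸ ht.2) (hzim ▸ hY0) him
  have hnorm : 1 < ‖reducedSymbol s z‖ := hY z (hzre ▸ ht) (hzim ▸ le_abs_self Y)
  rw [hreal, norm_real, Real.norm_of_nonneg hnonneg] at hnorm
  exact ⟨z, _, hzre ▸ ht, hnorm.le, hreal⟩

theorem reducedSymbol_notMem_image_Icc (hs0 : 0 < s) (hs1 : s < 1)
    (hx₁ : (reducedSymbol s (1 + s / 2 : ℝ)).re < 1)
    (hre : z.re = (s + 1) / 2 ∨ z.re = 1 + s / 2) (L : ℝ) :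
    reducedSymbol s z ∉ ofReal '' Icc 1 L := by
  rintro ⟨t, ht, hz⟩
  have him : z.im = 0 := by_contra fun him =>
    im_reducedSymbol_ne_zero_of_re_eq hs0 hs1 hre him (by rw [← hz, ofReal_im])
  have hlt : (reducedSymbol s z.re).re < 1 := by
    rcases hre with hre | hre
    · rw [hre]
      exact re_reducedSymbol_ofReal_lt_one hs0 hs1 (abs_lt.2 (by constructor <;> linarith))
        (by linarith) (by linarith)
    · rwa [hre]
  rw [show (z.re : ℂ) = z from Complex.ext rfl him.symm, ← hz, ofReal_re] at hlt
  exact hlt.not_ge ht.1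

theorem isOpenMap_reducedSymbol (hs0 : 0 < s) (hs1 : s < 1) : IsOpenMap (reducedSymbol s) := by
  rcases (analyticOnNhd_univ_iff_differentiable.2
    (differentiable_reducedSymbol s)).is_constant_or_isOpenMap with ⟨c, hc⟩ | h
  · obtain ⟨z, L, -, hL, hz⟩ := exists_reducedSymbol_eq_ofReal hs0 hs1
    have hlt := re_reducedSymbol_ofReal_lt_one hs0 hs1 (x := (s + 1) / 2)
      (abs_lt.2 (by constructor <;> linarith)) (by linarith) (by linarith)
    rw [hc, ← hc z, hz, ofReal_re] at hlt
    exact absurd hL hlt.not_ge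
  · exact h

theorem exists_reducedSymbol_eq_one_of_lt_one (hs0 : 0 < s) (hs1 : s < 1)
    (hx₁ : (reducedSymbol s (1 + s / 2 : ℝ)).re < 1) :
    ∃ z : ℂ, z.re ∈ Icc ((s + 1) / 2) (1 + s / 2) ∧ reducedSymbol s z = 1 := by
  have hle : (s + 1) / 2 ≤ 1 + s / 2 := by linarith
  obtain ⟨z₁, L, hz₁, hL, hz₁L⟩ := exists_reducedSymbol_eq_ofReal hs0 hs1
  obtain ⟨Y, hY0, hY⟩ := exists_lt_norm_reducedSymbol (symbolConst_pos hs0 hs1) ((s + 1) / 2)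
    (1 + s / 2) L
  have hsmall : ∀ {z : ℂ} {t : ℝ}, z.re ∈ Icc ((s + 1) / 2) (1 + s / 2) → t ∈ Icc 1 L →
      (t : ℂ) = reducedSymbol s z → |z.im| < Y := fun hre ht hz => not_le.1 fun him => by
    have := hY _ hre him
    rw [← hz, norm_real, Real.norm_of_nonneg (zero_le_one.trans ht.1)] at this
    exact this.not_ge ht.2
  have hsub : ofReal '' Icc 1 L ⊆
      reducedSymbol s '' (Icc ((s + 1) / 2) (1 + s / 2) ×ℂ Icc (-Y) Y) := by
    refine subset_image_of_disjoint_image_frontier (differentiable_reducedSymbol s).continuous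
      (isOpenMap_reducedSymbol hs0 hs1) (isCompact_Icc.reProdIm isCompact_Icc)
      (isPreconnected_Icc.image _ continuous_ofReal.continuousOn) ?_
      ⟨L, ⟨L, ⟨hL, le_rfl⟩, rfl⟩, z₁, ⟨hz₁, abs_le.1 ?_⟩, hz₁L⟩
    · rw [disjoint_right, frontier_reProdIm, closure_Icc, closure_Icc, frontier_Icc hle,
        frontier_Icc (by linarith)]
      rintro _ ⟨z, ⟨hre, him⟩ | ⟨hre, -⟩, rfl⟩
      · rintro ⟨t, ht, hz⟩
        exact (hsmall hre ht hz).ne ((abs_eq hY0.le).2 him.symm)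
      · exact reducedSymbol_notMem_image_Icc hs0 hs1 hx₁ hre L
    · exact (hsmall hz₁ ⟨hL, le_rfl⟩ hz₁L.symm).le
  obtain ⟨z, hz, hz1⟩ := hsub ⟨1, ⟨le_rfl, hL⟩, rfl⟩
  exact ⟨z, hz.1, hz1.trans ofReal_one⟩

theorem exists_reducedSymbol_eq_one (hs0 : 0 < s) (hs1 : s < 1) :
    ∃ z : ℂ, min (s + 1 / 2) 1 < z.re ∧ z.re ≤ 1 + s / 2 ∧ reducedSymbol s z = 1 := by
  have habs : |s - 1 / 2| < (s + 1) / 2 := abs_lt.2 (by constructor <;> linarith)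
  obtain ⟨z, hre, hz⟩ :
      ∃ z : ℂ, z.re ∈ Icc ((s + 1) / 2) (1 + s / 2) ∧ reducedSymbol s z = 1 := by
    rcases lt_or_ge (reducedSymbol s (1 + s / 2 : ℝ)).re 1 with hx₁ | hx₁
    · exact exists_reducedSymbol_eq_one_of_lt_one hs0 hs1 hx₁
    · have hcont : Continuous fun x : ℝ => (reducedSymbol s x).re :=
        continuous_re.comp ((differentiable_reducedSymbol s).continuous.comp continuous_ofReal)
      obtain ⟨x, hx, hx1⟩ := intermediate_value_Icc (by linarith) hcont.continuousOn
        ⟨(re_reducedSymbol_ofReal_lt_one hs0 hs1 habs (by linarith) (by linarith)).le, hx₁⟩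
      refine ⟨x, hx, Complex.ext hx1 ?_⟩
      rw [reducedSymbol_ofReal, ofReal_im, one_im]
  exact ⟨z, lt_of_not_ge fun h => reducedSymbol_ne_one hs0 hs1 (habs.trans_le hre.1) h hz,
    hre.2, hz⟩

end

theorem proposition1p3 (s : ℝ) (hs0 : 0 < s) (hs1 : s < 1) :
    (s ≤ 1 / 2 →
      (∃ α : ℝ, 0 < α ∧ ∀ β : ℂ, 0 < β.re → β.re < 2 * s + α →
        ¬ IsZeroOf (neumannSymbol s) β) ∧
      (∃ β : ℂ, 2 * s < β.re ∧ β.re < 2 * s + 1 / 2 ∧ IsZeroOf (neumannSymbol s) β)) ∧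
    (1 / 2 ≤ s →
      (∃ α : ℝ, 0 < α ∧ ∀ β : ℂ, 2 * s - 1 < β.re → β.re < s + 1 / 2 + α →
        ¬ IsZeroOf (neumannSymbol s) β) ∧
      (∃ β : ℂ, s + 1 / 2 < β.re ∧ β.re < s + 1 ∧ IsZeroOf (neumannSymbol s) β)) := by
  obtain ⟨α, hα, hgap⟩ := exists_pos_forall_reducedSymbol_ne_one hs0 hs1
  obtain ⟨z, hz0, hz1, hz⟩ := exists_reducedSymbol_eq_one hs0 hs1
  have hzero : IsZeroOf (neumannSymbol s) (z + s - 1 / 2) := by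
    rwa [isZeroOf_neumannSymbol_iff hs0 hs1,
      show z + s - 1 / 2 - s + 1 / 2 = z by ring]
  have hzre : (z + s - 1 / 2).re = z.re + s - 1 / 2 := by simp
  have hfree : ∀ β : ℂ, |s - 1 / 2| < β.re - s + 1 / 2 →
      β.re - s + 1 / 2 < min (s + 1 / 2) 1 + α → ¬ IsZeroOf (neumannSymbol s) β :=
    fun β h0 h1 => by
      rw [isZeroOf_neumannSymbol_iff hs0 hs1]
      exact hgap _ (by simpa using h0) (by simpa using h1)
  refine ⟨fun hs => ?_, fun hs => ?_⟩
  · rw [min_eq_left (by linarith)] at hfree hz0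
    rw [abs_of_nonpos (by linarith)] at hfree
    exact ⟨⟨α, hα, fun β h0 h1 => hfree β (by linarith) (by linarith)⟩,
      _, by linarith, by linarith, hzero⟩
  · rw [min_eq_right (by linarith)] at hfree hz0
    rw [abs_of_nonneg (by linarith)] at hfree
    exact ⟨⟨α, hα, fun β h0 h1 => hfree β (by linarith) (by linarith)⟩,
      _, by linarith, by linarith, hzero⟩
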